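/- Consider the Undecided-State Dynamics on $n$ nodes. At any time each node either has one of $k$ colors or is undecided. Rounds are synchronous: in each round every node $u$, independently of the other nodes and of the past, contacts a node $v$ chosen uniformly at random among all $n$ nodes (possibly $v=u$) and updates its state using the state of $v$ before the round: if $u$ is undecided, it takes the state of $v$; if $u$ has color $i$, it becomes undecided if $v$ has a color $j\neq i$, and keeps color $i$ otherwise. Let $\bar{\mathbf c}=(\bar c_1,\dots,\bar c_k)$ be the initial color configuration, where $\bar c_i$ is the number of nodes of color $i$ and $\sum_{i=1}^k \bar c_i=n$ (no node is undecided at the start), and let $$\mathsf{md}(\bar{\mathbf c})=\sum_{i=1}^k\Bigl(\frac{\bar c_i}{\max_{j}\bar c_j}\Bigr)^2$$ be its monochromatic distance. The convergence time $\tau$ is the first $t\ge 0$ such that after $t$ rounds all nodes are in the same state (all have the same color, or all are undecided); $\tau=\infty$ if there is no such $t$. **Theorem.** There are absolute constants $\varepsilon,a,b>0$ such that for all $n\geq 1$, all $k\le\varepsilon\,(n/\log n)^{1/6}$ (where, for $n=1$, the right-hand side is read as $0$), and every initial color configuration $\bar{\mathbf c}$ of $n$ nodes with colors from $\{1,\dots,k\}$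 in which at least two colors occur, $$\Pr\bigl[\tau\ge a\,\mathsf{md}(\bar{\mathbf c})\bigr]\ \ge\ 1-n^{-b}.$$ That is, the convergence time of the Undecided-State Dynamics is $\Omega(\mathsf{md}(\bar{\mathbf c}))$ with high probability. -/

import Mathlib

open MeasureTheory ProbabilityTheory

noncomputable section

/-- The update rule of the Undecided-State Dynamics: `usdUpdate s s'` is the new state of a node in
state `s` that contacts a node in state `s'`. States are `some i` (color `i`) and `none`
(undecided). An undecided node copies the state it sees; a colored node keeps its color if it sees
the same color or an undecided node, and becomes undecided if it sees a different color. -/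
def usdUpdate {K : Type*} [DecidableEq K] : Option K → Option K → Option K
  | none, s' => s'
  | some i, none => some i
  | some i, some j => if i = j then some i else none

/-- The trajectory of the (synchronous) Undecided-State Dynamics: `usdRun c contact t u` is the
state of node `u` after `t` rounds, when the dynamics starts from the coloring `c` (no node is
undecided at the start) and node `u` contacts node `contact t u` in the round leading from
time `t` to time `t + 1`. -/
def usdRun {V K : Type*} [DecidableEq K] (c : V → K) (contact : ℕ → V → V) : ℕ → V → Option K
  | 0, u => some (c u)
  | t + 1, u => usdUpdate (usdRun c contact t u) (usdRun c contact t (contact t u))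

/-- A configuration has converged if all nodes are in the same state, i.e. it is one of the
absorbing configurations of the dynamics. -/
def UsdConverged {V K : Type*} (x : V → Option K) : Prop :=
  ∃ s : Option K, ∀ u : V, x u = s

/-- The convergence time: the first time at which the configuration has converged
(`⊤` if there is none). -/
def usdConvergenceTime {V K : Type*} [DecidableEq K] (c : V → K) (contact : ℕ → V → V) : ℕ∞ :=
  ⨅ (t : ℕ) (_ : UsdConverged (usdRun c contact t)), (t : ℕ∞)

/-- The joint law of all contacts: in each round each of the `n` nodes contacts a node chosen
uniformly at random among all `n` nodes, independently over nodes and rounds. -/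
def contactLaw (n : ℕ) [NeZero n] : Measure (ℕ → Fin n → Fin n) :=
  Measure.infinitePi fun _ : ℕ =>
    Measure.pi fun _ : Fin n => (PMF.uniformOfFintype (Fin n)).toMeasure

/-- The number of nodes of color `i`. -/
def colorCount {V K : Type*} [Fintype V] [DecidableEq K] (c : V → K) (i : K) : ℕ :=
  (Finset.univ.filter fun u => c u = i).card

/-- The size of a largest color class. -/
def maxColorCount {V K : Type*} [Fintype V] [Fintype K] [DecidableEq K] (c : V → K) : ℕ :=
  Finset.univ.sup (colorCount c)

/-- The monochromatic distance `∑ i, (c_i / max_j c_j) ^ 2`. -/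
def monochromaticDistance {V K : Type*} [Fintype V] [Fintype K] [DecidableEq K] (c : V → K) : ℝ :=
  ∑ i : K, ((colorCount c i : ℝ) / (maxColorCount c : ℝ)) ^ 2

end

/-! Let `x i` be the fraction of color `i`, `S` the total colored fraction and `D` the monochromatic
distance. One round sends `x i` in expectation to `x i * (x i + 2 * (1 - S))`. The term `2 * (1 -
S)` is common to all colors, so relative sizes `x i / S` change only through the self-term `x i`. If
every relative size is at most `2 / D` and `S ≤ 3 / 4`, one round raises the bound on them by only
`O(1 / D ^ 2)` (`meanField_step`). The first round has `S = 1` and squares the fractions. With `m`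
the largest fraction, their sum becomes `D * m ^ 2`, so the largest relative size is about `1 / D`
(`meanField_first_step`). For `D / 32` rounds it then stays below `2 / D < 1`, while `S` stays at
least `1 / (2 * k)`: neither kind of absorbing configuration is reached. Randomness costs an error
`δ` per color and round. Hoeffding's inequality, applied given the state before the round
(`contactLaw_round_le`), and a union bound allow `δ = √(log n / n)`; the bound on `k` makes `k ^ 3 *
δ` small enough. -/

/-! ### The perturbed mean-field dynamics -/

theorem abs_sum_sub_sum_le {ι : Type*} [Fintype ι] {f g : ι → ℝ} {δ : ℝ}
    (h : ∀ i, |f i - g i| ≤ δ) : |∑ i, f i - ∑ i, g i| ≤ Fintype.card ι * δ := by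
  rw [← Finset.sum_sub_distrib]
  refine (Finset.abs_sum_le_sum_abs _ _).trans ?_
  simpa using Finset.sum_le_card_nsmul Finset.univ (fun i => |f i - g i|) δ fun i _ => h i

/-- Consequences of a bound on the error of one step that is cubically small in the number of
colors. -/
theorem error_bounds {k : ℕ} {D δ : ℝ} (hD : 32 ≤ D) (hDk : D ≤ k)
    (hδ : (k : ℝ) ^ 3 * δ ≤ 1 / 8) :
    0 < (1 / k : ℝ) ∧ 1 / (k : ℝ) ≤ 1 / D ∧ 1 / D ≤ 1 / 32 ∧ δ ≤ (1 / k : ℝ) ^ 3 / 8 ∧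
      k * δ ≤ (1 / k : ℝ) ^ 2 / 8 := by
  have hk : (0 : ℝ) < k := by linarith
  refine ⟨by positivity, one_div_le_one_div_of_le (by linarith) hDk,
    one_div_le_one_div_of_le (by norm_num) hD, ?_, ?_⟩
  · rw [one_div, inv_pow, inv_eq_one_div, div_div, le_div_iff₀ (by positivity)]
    linarith
  · rw [one_div, inv_pow, inv_eq_one_div, div_div, le_div_iff₀ (by positivity)]
    linarith

/-- One round of the perturbed mean-field dynamics keeps the total color fraction bounded away
from `0` and `1`, and increases the relative size of each color by at most `16 / D ^ 2`. -/
theorem meanField_step {k : ℕ} {x y : Fin k → ℝ} {D ρ δ : ℝ} (hx : ∀ i, 0 ≤ x i)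
    (hD : 32 ≤ D) (hDk : D ≤ k) (hδ : (k : ℝ) ^ 3 * δ ≤ 1 / 8)
    (hy : ∀ i, |y i - x i * (x i + 2 * (1 - ∑ j, x j))| ≤ δ)
    (hlo : 1 / (k : ℝ) / 2 ≤ ∑ j, x j) (hhi : ∑ j, x j ≤ 3 / 4)
    (hρ : ρ ≤ 2 * (1 / D)) (hxρ : ∀ i, x i ≤ ρ * ∑ j, x j) :
    1 / (k : ℝ) / 2 ≤ ∑ j, y j ∧ ∑ j, y j ≤ 3 / 4 ∧
      ∀ i, y i ≤ (ρ + 16 * (1 / D) ^ 2) * ∑ j, y j := by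
  obtain ⟨hκ0, hκr, hr, hδκ, heκ⟩ := error_bounds hD hDk hδ
  have hsum := abs_sum_sub_sum_le hy
  have hexp : ∑ i, x i * (x i + 2 * (1 - ∑ j, x j)) =
      ∑ i, x i ^ 2 + 2 * (∑ j, x j) * (1 - ∑ j, x j) := by
    simp only [mul_add, Finset.sum_add_distrib, ← Finset.sum_mul]
    congr 1
    · exact Finset.sum_congr rfl fun i _ => by ring
    · ring
  have hQ0 : 0 ≤ ∑ i, x i ^ 2 := Finset.sum_nonneg fun i _ => sq_nonneg _
  have hQ1 : ∑ i, x i ^ 2 ≤ ρ * (∑ j, x j) * ∑ j, x j := by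
    rw [Finset.mul_sum (a := ρ * ∑ j, x j)]
    refine Finset.sum_le_sum fun i _ => ?_
    rw [sq]
    exact mul_le_mul_of_nonneg_right (hxρ i) (hx i)
  rw [hexp, Fintype.card_fin] at hsum
  obtain ⟨i₀⟩ : Nonempty (Fin k) := ⟨⟨0, by
    have : (0 : ℝ) < k := by linarith
    exact_mod_cast this⟩⟩
  generalize ∑ i, x i ^ 2 = Q at *
  generalize ∑ j, x j = S at *
  generalize ∑ j, y j = T at *
  generalize (k : ℝ) * δ = e at *
  generalize 1 / (k : ℝ) = κ at *
  generalize 1 / D = r at *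
  have hS : 0 < S := by linarith
  have hρ0 : 0 ≤ ρ := nonneg_of_mul_nonneg_left ((hx i₀).trans (hxρ i₀)) hS
  obtain ⟨h1, h2⟩ := abs_le.1 hsum
  have hκ2 : κ ^ 2 ≤ κ / 32 := by nlinarith
  have hr0 : 0 < r := by linarith
  have hlow : 2 * S * (1 - S) - e ≤ T := by linarith
  refine ⟨?_, ?_, fun i => ?_⟩
  -- Up to the error, a total below `1 / 4` grows by a factor `3 / 2`, and a larger one stays above
  -- `1 / 8`.
  · rcases le_total S (1 / 4) with h | h
    · have : S * (1 - S) ≥ S * (3 / 4) := mul_le_mul_of_nonneg_left (by linarith) hS.le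
      linarith
    · have : S * (1 - S) ≥ 1 / 4 * (1 / 4) := mul_le_mul h (by linarith) (by norm_num) hS.le
      linarith
  · have hρS : ρ * S ≤ 1 / 16 * 1 := mul_le_mul (by linarith) (by linarith) hS.le (by norm_num)
    have : ρ * S * S ≤ 1 / 16 * 1 := mul_le_mul (by linarith) (by linarith) hS.le (by norm_num)
    nlinarith [sq_nonneg (S - 1 / 2)]
  · have hyi := (abs_le.1 (hy i)).2
    have hxi : x i * (x i + 2 * (1 - S)) ≤ ρ * S * (ρ * S + 2 * (1 - S)) :=
      mul_le_mul (hxρ i) (by linarith [hxρ i]) (by linarith [hx i]) (by positivity)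
    have ha : 0 ≤ ρ + 16 * r ^ 2 := by positivity
    have h3 := mul_le_mul_of_nonneg_left hlow ha
    have hr2 : r ^ 2 ≤ r / 32 := by nlinarith
    have hρ2 : (ρ * S) * (ρ * S) ≤ 4 * r ^ 2 * S := by
      have h5 : ρ * ρ ≤ (2 * r) * (2 * r) := mul_le_mul hρ hρ hρ0 (by linarith)
      have h6 : S * S ≤ S := by nlinarith
      nlinarith [mul_le_mul h5 h6 (by positivity) (by positivity)]
    have hκr2 : κ ^ 2 ≤ r ^ 2 := by gcongr
    -- This forces the cube in `hδ`: only `r ≥ κ` and `S ≥ κ / 2` are known.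
    have h7 : δ ≤ r ^ 2 * S / 4 := by
      have : κ ^ 2 * κ ≤ r ^ 2 * (2 * S) :=
        mul_le_mul hκr2 (by linarith) hκ0.le (by positivity)
      nlinarith
    have he : e ≤ r * S / 4 := by
      have : κ * κ ≤ r * (2 * S) := mul_le_mul hκr (by linarith) hκ0.le hr0.le
      nlinarith
    have h8 : (ρ + 16 * r ^ 2) * e ≤ (3 * r) * (r * S / 4) :=
      (mul_le_mul_of_nonneg_left he ha).trans
        (mul_le_mul_of_nonneg_right (by linarith) (by positivity))
    have h9 : r ^ 2 * S * (1 / 4) ≤ r ^ 2 * S * (1 - S) :=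
      mul_le_mul_of_nonneg_left (by linarith) (by positivity)
    have h10 : 0 < r ^ 2 * S := by positivity
    linarith

/-- The first round of the perturbed mean-field dynamics, started without undecided nodes. -/
theorem meanField_first_step {k : ℕ} {x y : Fin k → ℝ} {D m δ : ℝ} (hx : ∀ i, 0 ≤ x i)
    (hD : 32 ≤ D) (hDk : D ≤ k) (hδ : (k : ℝ) ^ 3 * δ ≤ 1 / 8)
    (hy : ∀ i, |y i - x i * (x i + 2 * (1 - ∑ j, x j))| ≤ δ)
    (hsum : ∑ j, x j = 1) (hm : ∀ i, x i ≤ m) (hDm : ∑ i, x i ^ 2 = D * m ^ 2) :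
    1 / (k : ℝ) / 2 ≤ ∑ j, y j ∧ ∑ j, y j ≤ 3 / 4 ∧
      ∀ i, y i ≤ 5 / 4 * (1 / D) * ∑ j, y j := by
  obtain ⟨hκ0, hκr, hr, hδκ, heκ⟩ := error_bounds hD hDk hδ
  have hk : (0 : ℝ) < k := by linarith
  have hy' : ∀ i, |y i - x i ^ 2| ≤ δ := fun i => by
    have := hy i
    rw [hsum] at this
    convert this using 2
    ring
  have hT := abs_sum_sub_sum_le hy'
  rw [Fintype.card_fin, hDm] at hT
  -- Cauchy–Schwarz keeps the colored fraction after the first round near `1 / k` or above.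
  have hcs : 1 ≤ k * (D * m ^ 2) := by
    have := sq_sum_le_card_mul_sum_sq (s := Finset.univ) (f := x)
    rw [hsum, hDm] at this
    simpa using this
  have hmk : 1 ≤ k * m := by
    have := Finset.sum_le_card_nsmul Finset.univ x m fun i _ => hm i
    rw [hsum] at this
    simpa using this
  have hm0 : 0 < m := pos_of_mul_pos_right (by linarith) hk.le
  have hDm1 : D * m ^ 2 ≤ m := by
    rw [← hDm, ← mul_one m, ← hsum, Finset.mul_sum]
    refine Finset.sum_le_sum fun i _ => ?_
    rw [sq]
    exact mul_le_mul_of_nonneg_right (hm i) (hx i)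
  have hmr : m ≤ 1 / D := by
    rw [le_div_iff₀ (by linarith)]
    nlinarith
  have hκm : 1 / (k : ℝ) ≤ m := by
    rw [div_le_iff₀ hk]
    linarith
  have hκD : 1 / (k : ℝ) ≤ D * m ^ 2 := by
    rw [div_le_iff₀ hk]
    linarith
  have hrD : 1 / D * (D * m ^ 2) = m ^ 2 := by
    field_simp
  generalize D * m ^ 2 = Q at *
  generalize ∑ j, y j = T at *
  generalize (k : ℝ) * δ = e at *
  generalize 1 / (k : ℝ) = κ at *
  generalize 1 / D = r at *
  obtain ⟨h1, h2⟩ := abs_le.1 hT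
  have hκ2 : κ ^ 2 ≤ κ / 32 := by nlinarith
  have hκm2 : κ ^ 2 ≤ m ^ 2 := by gcongr
  have hr0 : 0 < r := by linarith
  refine ⟨by linarith, by linarith, fun i => ?_⟩
  have hyi := (abs_le.1 (hy' i)).2
  have hxi : x i ^ 2 ≤ m ^ 2 := pow_le_pow_left₀ (hx i) (hm i) 2
  have h3 : r * (Q - e) ≤ r * T := mul_le_mul_of_nonneg_left (by linarith) hr0.le
  have h4 : r * e ≤ 1 / 32 * (m ^ 2 / 8) :=
    (mul_le_mul_of_nonneg_left (heκ.trans (by linarith)) hr0.le).trans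
      (mul_le_mul_of_nonneg_right hr (by positivity))
  have h5 : κ ^ 3 ≤ m ^ 2 / 32 := by
    have : κ ^ 2 * κ ≤ m ^ 2 * (1 / 32) :=
      mul_le_mul hκm2 (by linarith) hκ0.le (by positivity)
    linarith
  have h6 : 0 < m ^ 2 := by positivity
  nlinarith

/-- The perturbed mean-field dynamics over `D / 32` rounds. -/
theorem meanField_run {k : ℕ} {x : ℕ → Fin k → ℝ} {D m δ : ℝ} (hx : ∀ t i, 0 ≤ x t i)
    (hD : 32 ≤ D) (hDk : D ≤ k) (hδ : (k : ℝ) ^ 3 * δ ≤ 1 / 8) {T : ℕ}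
    (hT : (T : ℝ) ≤ D / 32)
    (hy : ∀ t < T, ∀ i, |x (t + 1) i - x t i * (x t i + 2 * (1 - ∑ j, x t j))| ≤ δ)
    (hsum : ∑ j, x 0 j = 1) (hm : ∀ i, x 0 i ≤ m) (hDm : ∑ i, x 0 i ^ 2 = D * m ^ 2) :
    ∀ t < T, 1 / (k : ℝ) / 2 ≤ ∑ j, x (t + 1) j ∧ ∑ j, x (t + 1) j ≤ 3 / 4 ∧
      ∀ i, x (t + 1) i ≤ (5 / 4 * (1 / D) + 16 * (1 / D) ^ 2 * t) * ∑ j, x (t + 1) j := by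
  intro t
  induction t with
  | zero =>
    intro ht
    simpa using meanField_first_step (hx 0) hD hDk hδ (hy 0 ht) hsum hm hDm
  | succ t ih =>
    intro ht
    obtain ⟨h1, h2, h3⟩ := ih (by omega)
    -- The accumulated increase is at most `16 / 32` of `1 / D`, and `5 / 4 + 1 / 2 ≤ 2`.
    have htD : (1 / D) ^ 2 * t ≤ 1 / D * (1 / 32) := by
      have h4 : (t : ℝ) ≤ D / 32 := le_trans (by exact_mod_cast (by omega : t ≤ T)) hT
      calc (1 / D) ^ 2 * t ≤ (1 / D) ^ 2 * (D / 32) := by gcongr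
        _ = 1 / D * (1 / 32) := by field_simp
    have hr0 : 0 < 1 / D := by positivity
    have := meanField_step (hx (t + 1)) hD hDk hδ (hy (t + 1) ht) h1 h2 (by linarith) h3
    refine ⟨this.1, this.2.1, fun i => (this.2.2 i).trans_eq ?_⟩
    push_cast
    ring

/-! ### Concentration within one round -/

/-- The law of the contacts of one round. -/
noncomputable def roundLaw (n : ℕ) [NeZero n] : Measure (Fin n → Fin n) :=
  Measure.pi fun _ : Fin n => (PMF.uniformOfFintype (Fin n)).toMeasure

instance (n : ℕ) [NeZero n] : IsProbabilityMeasure (roundLaw n) := by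
  unfold roundLaw; infer_instance

instance (n : ℕ) [NeZero n] : IsProbabilityMeasure (contactLaw n) := by
  unfold contactLaw; infer_instance

theorem integral_roundLaw_eval (n : ℕ) [NeZero n] (g : Fin n → ℝ) (u : Fin n) :
    ∫ f, g (f u) ∂(roundLaw n) = (∑ v, g v) / n := by
  have h := (measurePreserving_eval
    (fun _ : Fin n => (PMF.uniformOfFintype (Fin n)).toMeasure) u)
  have h2 := integral_map (μ := roundLaw n) h.measurable.aemeasurable (f := g)
    (Measurable.of_discrete.aestronglyMeasurable)
  rw [show Measure.map (Function.eval u) (roundLaw n) = _ from h.map_eq] at h2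
  simp only [Function.eval] at h2
  rw [← h2, PMF.integral_eq_sum]
  simp [div_eq_inv_mul, Finset.mul_sum]

/-- Hoeffding's inequality for a sum of functions of the contacts of one round (upper tail). -/
theorem roundLaw_tail (n : ℕ) [NeZero n] (g : Fin n → Fin n → ℝ) (a : ℝ)
    (hg : ∀ u v, g u v ∈ Set.Icc a (a + 1)) {δ : ℝ} (hδ : 0 ≤ δ) :
    (roundLaw n).real {f | n * δ ≤ ∑ u, g u (f u) - ∑ u, (∑ v, g u v) / n} ≤
      Real.exp (-2 * n * δ ^ 2) := by
  have hn : (0 : ℝ) < n := by exact_mod_cast Nat.pos_of_ne_zero (NeZero.ne n)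
  have hind : iIndepFun (fun u (f : Fin n → Fin n) => g u (f u) - (∑ v, g u v) / n)
      (roundLaw n) :=
    iIndepFun_pi (X := fun u v => g u v - (∑ v, g u v) / n)
      fun u => Measurable.of_discrete.aemeasurable
  have hsub : ∀ u ∈ Finset.univ, HasSubgaussianMGF
      (fun (f : Fin n → Fin n) => g u (f u) - (∑ v, g u v) / n) (1 / 4) (roundLaw n) := by
    intro u _
    have := hasSubgaussianMGF_of_mem_Icc (μ := roundLaw n) (X := fun f => g u (f u))
      (a := a) (b := a + 1) Measurable.of_discrete.aemeasurable
      (Filter.Eventually.of_forall fun f => hg u (f u))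
    rw [integral_roundLaw_eval] at this
    convert this using 1
    simp
    norm_num
  have h := HasSubgaussianMGF.measure_sum_ge_le_of_iIndepFun hind hsub
    (ε := n * δ) (by positivity)
  simp only [Finset.sum_sub_distrib] at h
  refine h.trans_eq ?_
  congr 1
  simp
  field_simp
  norm_num

/-- Hoeffding's inequality for a sum of functions of the contacts of one round. -/
theorem roundLaw_deviation (n : ℕ) [NeZero n] (g : Fin n → Fin n → ℝ)
    (hg : ∀ u v, g u v ∈ Set.Icc (0 : ℝ) 1) {δ : ℝ} (hδ : 0 ≤ δ) :
    (roundLaw n).real {f | n * δ ≤ |∑ u, g u (f u) - ∑ u, (∑ v, g u v) / n|} ≤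
      2 * Real.exp (-2 * n * δ ^ 2) := by
  have h1 := roundLaw_tail n g 0 (by simpa using hg) hδ
  have h2 := roundLaw_tail n (fun u v => -g u v) (-1) (fun u v => by
    have := hg u v
    constructor <;> linarith [this.1, this.2]) hδ
  refine (measureReal_mono (s₂ := {f | n * δ ≤ ∑ u, g u (f u) - ∑ u, (∑ v, g u v) / n} ∪
    {f | n * δ ≤ ∑ u, -g u (f u) - ∑ u, (∑ v, -g u v) / n}) ?_).trans
    ((measureReal_union_le _ _).trans (by linarith))
  intro f hf
  rcases le_abs.1 (show n * δ ≤ |_| from hf) with h | h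
  · exact Or.inl h
  · right
    simp only [Set.mem_ofPred_eq, Finset.sum_neg_distrib, neg_div]
    linarith

/-! ### Independence of a round from the past -/

theorem usdRun_congr {V K : Type*} [DecidableEq K] (c : V → K) {ω ω' : ℕ → V → V} {t : ℕ}
    (h : ∀ s < t, ω s = ω' s) : usdRun c ω t = usdRun c ω' t := by
  induction t with
  | zero => rfl
  | succ t ih =>
    funext u
    simp only [usdRun]
    rw [ih fun s hs => h s (by omega), h t (by omega)]

/-- The state after `t` rounds is a function of the contacts of the first `t` rounds. -/
theorem exists_usdRun_eq {n k : ℕ} (c : Fin n → Fin k) (t : ℕ) :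
    ∃ F : (Finset.range t → Fin n → Fin n) → Fin n → Option (Fin k),
      (fun ω : ℕ → Fin n → Fin n => usdRun c ω t) = F ∘ fun ω s => ω s := by
  -- The default `id` is never read: the first `t` rounds use only the contacts in `p`.
  refine ⟨fun p => usdRun c (fun s => if hs : s ∈ Finset.range t then p ⟨s, hs⟩ else id) t, ?_⟩
  funext ω
  refine usdRun_congr c fun s hs => ?_
  simp [hs]

theorem measurable_usdRun {n k : ℕ} (c : Fin n → Fin k) (t : ℕ) :
    @Measurable _ _ _ ⊤ fun ω : ℕ → Fin n → Fin n => usdRun c ω t := by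
  let _ : MeasurableSpace (Fin n → Option (Fin k)) := ⊤
  obtain ⟨F, hF⟩ := exists_usdRun_eq c t
  rw [hF]
  exact Measurable.of_discrete.comp (by fun_prop)

/-- The state depends on the rounds before `t` only, a set of indices disjoint from `{t}`. -/
theorem indepFun_usdRun {n k : ℕ} [NeZero n] (c : Fin n → Fin k) (t : ℕ) :
    @IndepFun _ _ _ _ ⊤ _ (fun ω : ℕ → Fin n → Fin n => usdRun c ω t) (fun ω => ω t)
      (contactLaw n) := by
  have hind : iIndepFun (fun s (ω : ℕ → Fin n → Fin n) => ω s) (contactLaw n) :=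
    iIndepFun_infinitePi (P := fun _ : ℕ => roundLaw n) (X := fun _ f => f)
      fun _ => measurable_id
  have h := hind.indepFun_finset (Finset.range t) {t} (by simp) fun s => measurable_pi_apply s
  let _ : MeasurableSpace (Fin n → Option (Fin k)) := ⊤
  obtain ⟨F, hF⟩ := exists_usdRun_eq c t
  rw [hF]
  exact h.comp (φ := F) (ψ := fun p : ({t} : Finset ℕ) → Fin n → Fin n => p ⟨t, by simp⟩)
    Measurable.of_discrete Measurable.of_discrete

/-- A bound on the probability of a bad round that holds whatever the state before the round. -/
theorem contactLaw_round_le {n k : ℕ} [NeZero n] (c : Fin n → Fin k) (t : ℕ)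
    (B : (Fin n → Option (Fin k)) → Set (Fin n → Fin n)) {p : ℝ}
    (hB : ∀ x, (roundLaw n).real (B x) ≤ p) :
    (contactLaw n).real {ω | ω t ∈ B (usdRun c ω t)} ≤ p := by
  classical
  let _ : MeasurableSpace (Fin n → Option (Fin k)) := ⊤
  have hind := indepFun_usdRun c t
  have hlaw : ∀ s : Set (Fin n → Fin n),
      (contactLaw n).real ((fun ω => ω t) ⁻¹' s) = (roundLaw n).real s := fun s =>
    measureReal_def _ _ ▸ measureReal_def _ _ ▸ congrArg ENNReal.toReal
      ((measurePreserving_eval_infinitePi (fun _ : ℕ => roundLaw n) t).measure_preimage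
        (Set.toFinite s).measurableSet.nullMeasurableSet)
  -- Conditioning on the state is a split over its finitely many values; independence factors each
  -- term.
  calc (contactLaw n).real {ω | ω t ∈ B (usdRun c ω t)}
      ≤ (contactLaw n).real (⋃ x, (fun ω => usdRun c ω t) ⁻¹' {x} ∩ (fun ω => ω t) ⁻¹' B x) := by
        refine measureReal_mono fun ω hω => ?_
        simpa using hω
    _ ≤ ∑ x, (contactLaw n).real ((fun ω => usdRun c ω t) ⁻¹' {x} ∩ (fun ω => ω t) ⁻¹' B x) :=
        measureReal_iUnion_fintype_le _
    _ = ∑ x, (contactLaw n).real ((fun ω => usdRun c ω t) ⁻¹' {x}) * (roundLaw n).real (B x) := by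
        refine Finset.sum_congr rfl fun x _ => ?_
        rw [← hlaw]
        simp only [measureReal_def]
        rw [hind.measure_inter_preimage_eq_mul _ _ (by trivial)
          (Set.toFinite _).measurableSet, ENNReal.toReal_mul]
    _ ≤ ∑ x, (contactLaw n).real ((fun ω => usdRun c ω t) ⁻¹' {x}) * p :=
        Finset.sum_le_sum fun x _ => mul_le_mul_of_nonneg_left (hB x) measureReal_nonneg
    _ = p := by
        rw [← Finset.sum_mul, sum_measureReal_preimage_singleton _ fun x _ =>
          measurable_usdRun c t (by trivial)]
        simp

/-! ### Evolution of the color fractions -/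

/-- The fraction of nodes in state `some i`. -/
noncomputable def colorFraction {n k : ℕ} (x : Fin n → Option (Fin k)) (i : Fin k) : ℝ :=
  (∑ u, if x u = some i then (1 : ℝ) else 0) / n

theorem colorFraction_nonneg {n k : ℕ} (x : Fin n → Option (Fin k)) (i : Fin k) :
    0 ≤ colorFraction x i :=
  div_nonneg (Finset.sum_nonneg fun _ _ => by split_ifs <;> norm_num) (Nat.cast_nonneg n)

theorem sum_indicator_some {k : ℕ} (s : Option (Fin k)) :
    (∑ i, if s = some i then (1 : ℝ) else 0) = if s = none then 0 else 1 := by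
  cases s <;> simp

theorem one_sub_sum_colorFraction {n k : ℕ} [NeZero n] (x : Fin n → Option (Fin k)) :
    1 - ∑ i, colorFraction x i = (∑ u, if x u = none then (1 : ℝ) else 0) / n := by
  have hn : (n : ℝ) ≠ 0 := by exact_mod_cast NeZero.ne n
  have h : ∑ u, (if x u = none then (1 : ℝ) else 0) =
      ∑ u, (1 - ∑ i, if x u = some i then (1 : ℝ) else 0) :=
    Finset.sum_congr rfl fun u _ => by
      rw [sum_indicator_some]
      split_ifs <;> norm_num
  simp only [colorFraction]
  rw [← Finset.sum_div, Finset.sum_comm, h, Finset.sum_sub_distrib]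
  simp [sub_div, hn]

/-- Each term is a product of a function of `s` and one of `s'`, so the double sum over nodes and
contacts factors into color fractions. -/
theorem usdUpdate_indicator {K : Type*} [DecidableEq K] (s s' : Option K) (i : K) :
    (if usdUpdate s s' = some i then (1 : ℝ) else 0) =
      (if s = none then 1 else 0) * (if s' = some i then 1 else 0) +
        (if s = some i then 1 else 0) *
          ((if s' = some i then 1 else 0) + if s' = none then 1 else 0) := by
  cases s <;> cases s' <;> simp only [usdUpdate] <;> grind

/-- The expected fraction of a color after one round. -/
theorem expected_colorFraction {n k : ℕ} [NeZero n] (x : Fin n → Option (Fin k)) (i : Fin k) :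
    ∑ u, (∑ v, if usdUpdate (x u) (x v) = some i then (1 : ℝ) else 0) / n =
      n * (colorFraction x i * (colorFraction x i + 2 * (1 - ∑ j, colorFraction x j))) := by
  have hn : (n : ℝ) ≠ 0 := by exact_mod_cast NeZero.ne n
  rw [one_sub_sum_colorFraction]
  simp only [usdUpdate_indicator, colorFraction, Finset.sum_add_distrib, ← Finset.mul_sum,
    ← Finset.sum_mul, ← Finset.sum_div]
  field_simp
  ring

/-- Concentration of the fraction of a color after one round. -/
theorem roundLaw_colorFraction_deviation {n k : ℕ} [NeZero n] (x : Fin n → Option (Fin k))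
    (i : Fin k) {δ : ℝ} (hδ : 0 ≤ δ) :
    (roundLaw n).real {f | δ ≤ |colorFraction (fun u => usdUpdate (x u) (x (f u))) i -
      colorFraction x i * (colorFraction x i + 2 * (1 - ∑ j, colorFraction x j))|} ≤
      2 * Real.exp (-2 * n * δ ^ 2) := by
  have hn : (0 : ℝ) < n := by exact_mod_cast Nat.pos_of_ne_zero (NeZero.ne n)
  refine le_trans (measureReal_mono fun f hf => ?_) (roundLaw_deviation n
    (fun u v => if usdUpdate (x u) (x v) = some i then (1 : ℝ) else 0)
    (fun u v => by split_ifs <;> norm_num) hδ)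
  simp only [Set.mem_ofPred_eq] at hf ⊢
  rw [expected_colorFraction]
  have h := mul_le_mul_of_nonneg_left hf hn.le
  rw [← abs_of_pos hn, ← abs_mul, abs_of_pos hn, mul_sub] at h
  refine h.trans_eq ?_
  rw [colorFraction, mul_div_cancel₀ _ hn.ne']

/-- With high probability, no color deviates much from its expectation in the first `T` rounds. -/
theorem contactLaw_deviation {n k : ℕ} [NeZero n] (c : Fin n → Fin k) (T : ℕ) {δ : ℝ}
    (hδ : 0 ≤ δ) :
    1 - T * (k * (2 * Real.exp (-2 * n * δ ^ 2))) ≤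
      (contactLaw n).real {ω | ∀ t < T, ∀ i,
        |colorFraction (usdRun c ω (t + 1)) i - colorFraction (usdRun c ω t) i *
          (colorFraction (usdRun c ω t) i +
            2 * (1 - ∑ j, colorFraction (usdRun c ω t) j))| ≤ δ} := by
  set G := {ω : ℕ → Fin n → Fin n | ∀ t < T, ∀ i,
        |colorFraction (usdRun c ω (t + 1)) i - colorFraction (usdRun c ω t) i *
          (colorFraction (usdRun c ω t) i +
            2 * (1 - ∑ j, colorFraction (usdRun c ω t) j))| ≤ δ} with hG
  let B : Fin k → (Fin n → Option (Fin k)) → Set (Fin n → Fin n) := fun i x =>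
    {f | δ ≤ |colorFraction (fun u => usdUpdate (x u) (x (f u))) i -
      colorFraction x i * (colorFraction x i + 2 * (1 - ∑ j, colorFraction x j))|}
  have hcov : Set.univ ⊆ G ∪ ⋃ t ∈ Finset.range T, ⋃ i,
      {ω : ℕ → Fin n → Fin n | ω t ∈ B i (usdRun c ω t)} := by
    intro ω _
    by_cases h : ω ∈ G
    · exact Or.inl h
    · right
      simp only [hG, Set.mem_ofPred_eq, not_forall, not_le] at h
      obtain ⟨t, ht, i, h⟩ := h
      simp only [Set.mem_iUnion, Finset.mem_range]
      exact ⟨t, ht, i, h.le⟩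
  have hbad : (contactLaw n).real (⋃ t ∈ Finset.range T, ⋃ i,
      {ω : ℕ → Fin n → Fin n | ω t ∈ B i (usdRun c ω t)}) ≤
      T * (k * (2 * Real.exp (-2 * n * δ ^ 2))) := by
    refine (measureReal_biUnion_finset_le _ _).trans ?_
    refine (Finset.sum_le_card_nsmul _ _ (k * (2 * Real.exp (-2 * n * δ ^ 2)))
      fun t _ => ?_).trans (by simp)
    refine (measureReal_iUnion_fintype_le _).trans ?_
    refine (Finset.sum_le_card_nsmul _ _ (2 * Real.exp (-2 * n * δ ^ 2))
      fun i _ => ?_).trans (by simp)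
    exact contactLaw_round_le c t (B i) fun x => roundLaw_colorFraction_deviation x i hδ
  have h1 := (measureReal_mono (μ := contactLaw n) hcov).trans (measureReal_union_le _ _)
  rw [probReal_univ] at h1
  linarith

/-! ### Initial configuration and non-convergence -/

theorem colorFraction_some {n k : ℕ} (c : Fin n → Fin k) (i : Fin k) :
    colorFraction (fun u => some (c u)) i = colorCount c i / n := by
  simp [colorFraction, colorCount]

theorem sum_colorFraction_some {n k : ℕ} [NeZero n] (c : Fin n → Fin k) :
    ∑ i, colorFraction (fun u => some (c u)) i = 1 := by
  have := one_sub_sum_colorFraction fun u => some (c u)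
  simp at this
  linarith

theorem maxColorCount_pos {n k : ℕ} [NeZero n] (c : Fin n → Fin k) : 0 < maxColorCount c := by
  refine lt_of_lt_of_le ?_ (Finset.le_sup (f := colorCount c) (Finset.mem_univ (c 0)))
  exact Finset.card_pos.2 ⟨0, by simp⟩

theorem monochromaticDistance_le {n k : ℕ} [NeZero n] (c : Fin n → Fin k) :
    monochromaticDistance c ≤ k := by
  have hM : (0 : ℝ) < maxColorCount c := by exact_mod_cast maxColorCount_pos c
  refine (Finset.sum_le_card_nsmul Finset.univ _ 1 fun i _ => ?_).trans (by simp)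
  refine pow_le_one₀ (by positivity) ((div_le_one hM).2 ?_)
  exact_mod_cast Finset.le_sup (f := colorCount c) (Finset.mem_univ i)

/-- This is how the monochromatic distance enters: as the `D` of `meanField_first_step`. -/
theorem sum_sq_colorFraction_some {n k : ℕ} [NeZero n] (c : Fin n → Fin k) :
    ∑ i, colorFraction (fun u => some (c u)) i ^ 2 =
      monochromaticDistance c * ((maxColorCount c : ℝ) / n) ^ 2 := by
  have hM : (maxColorCount c : ℝ) ≠ 0 := by exact_mod_cast (maxColorCount_pos c).ne'
  rw [monochromaticDistance, Finset.sum_mul]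
  refine Finset.sum_congr rfl fun i _ => ?_
  rw [colorFraction_some, ← mul_pow, div_mul_div_cancel₀ hM]

theorem not_converged_of_colorFraction {n k : ℕ} [NeZero n] {x : Fin n → Option (Fin k)}
    (h0 : 0 < ∑ i, colorFraction x i)
    (h : ∀ i, colorFraction x i < ∑ j, colorFraction x j) : ¬ UsdConverged x := by
  rintro ⟨s, hs⟩
  obtain rfl : x = fun _ => s := funext hs
  cases s with
  | none => simp [colorFraction] at h0
  | some i =>
    have h1 := h i
    rw [Finset.sum_eq_single_of_mem i (Finset.mem_univ i) fun j _ hj => by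
      simp [colorFraction, hj.symm]] at h1
    exact lt_irrefl _ h1

theorem le_usdConvergenceTime {V K : Type*} [DecidableEq K] {c : V → K} {contact : ℕ → V → V}
    {T : ℕ} {a : ℝ} (ha : a ≤ T) (h : ∀ t < T, ¬ UsdConverged (usdRun c contact t)) :
    ENNReal.ofReal a ≤ (usdConvergenceTime c contact : ENNReal) := by
  have hT : (T : ℕ∞) ≤ usdConvergenceTime c contact :=
    le_iInf₂ fun t ht => by
      by_contra hlt
      exact h t (by exact_mod_cast not_le.1 hlt) ht
  calc ENNReal.ofReal a ≤ ENNReal.ofReal T := ENNReal.ofReal_le_ofReal ha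
    _ = ((T : ℕ∞) : ENNReal) := by simp
    _ ≤ _ := ENat.toENNReal_le.2 hT

theorem not_converged_zero {n k : ℕ} {c : Fin n → Fin k} (hc : ∃ u v, c u ≠ c v)
    (contact : ℕ → Fin n → Fin n) : ¬ UsdConverged (usdRun c contact 0) := by
  rintro ⟨s, hs⟩
  obtain ⟨u, v, huv⟩ := hc
  exact huv (Option.some_injective _ ((hs u).trans (hs v).symm))

/-- If no color deviates much from its expectation, then the dynamics does not converge within
a time proportional to the monochromatic distance. -/
theorem not_converged_of_deviation_le {n k : ℕ} [NeZero n] {c : Fin n → Fin k}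
    (hc : ∃ u v, c u ≠ c v) {ω : ℕ → Fin n → Fin n} {δ : ℝ} {T : ℕ}
    (hD : 32 ≤ monochromaticDistance c) (hδ : (k : ℝ) ^ 3 * δ ≤ 1 / 8)
    (hT : (T : ℝ) ≤ monochromaticDistance c / 32)
    (hω : ∀ t < T, ∀ i,
        |colorFraction (usdRun c ω (t + 1)) i - colorFraction (usdRun c ω t) i *
          (colorFraction (usdRun c ω t) i +
            2 * (1 - ∑ j, colorFraction (usdRun c ω t) j))| ≤ δ) :
    ∀ t < T + 1, ¬ UsdConverged (usdRun c ω t) := by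
  have hn : (0 : ℝ) < n := by exact_mod_cast Nat.pos_of_ne_zero (NeZero.ne n)
  intro t ht
  cases t with
  | zero => exact not_converged_zero hc ω
  | succ t =>
    have hDk := monochromaticDistance_le c
    have htT : t < T := by omega
    have hmax : ∀ i, colorFraction (usdRun c ω 0) i ≤ maxColorCount c / n := fun i => by
      change colorFraction (fun u => some (c u)) i ≤ _
      rw [colorFraction_some]
      gcongr
      exact Finset.le_sup (f := colorCount c) (Finset.mem_univ i)
    obtain ⟨h1, -, h3⟩ := meanField_run (x := fun t => colorFraction (usdRun c ω t))
      (m := maxColorCount c / n) (fun t => colorFraction_nonneg _) hD hDk hδ hT hω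
      (sum_colorFraction_some c) hmax (sum_sq_colorFraction_some c) t htT
    have hk : (0 : ℝ) < 1 / k := by
      have : (0 : ℝ) < k := by linarith
      positivity
    have hS : 0 < ∑ j, colorFraction (usdRun c ω (t + 1)) j := by linarith
    refine not_converged_of_colorFraction hS fun i => (h3 i).trans_lt ?_
    have hr : 1 / monochromaticDistance c ≤ 1 / 32 :=
      one_div_le_one_div_of_le (by norm_num) hD
    have hr0 : 0 < 1 / monochromaticDistance c := by positivity
    have htD : (1 / monochromaticDistance c) ^ 2 * t ≤ 1 / monochromaticDistance c * (1 / 32) := by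
      have h4 : (t : ℝ) ≤ monochromaticDistance c / 32 :=
        le_trans (by exact_mod_cast htT.le) hT
      calc (1 / monochromaticDistance c) ^ 2 * t
          ≤ (1 / monochromaticDistance c) ^ 2 * (monochromaticDistance c / 32) := by gcongr
        _ = 1 / monochromaticDistance c * (1 / 32) := by field_simp
    exact mul_lt_of_lt_one_left hS (by linarith)

/-! ### Choice of the constants -/

/-- Consequences of the upper bound on the number of colors. -/
theorem color_number_bounds {n k : ℕ} (hk : 32 ≤ k)
    (h : (k : ℝ) ≤ 1 / 2 * ((n : ℝ) / Real.log n) ^ ((1 : ℝ) / 6)) :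
    1 < n ∧ 2 * (k : ℝ) ^ 2 ≤ n ∧ (k : ℝ) ^ 3 * √(Real.log n / n) ≤ 1 / 8 := by
  have hk' : (32 : ℝ) ≤ k := by exact_mod_cast hk
  have hn : 1 < n := by
    -- For `n = 0` and `n = 1` the logarithm and the quotient by it are `0`, so `h` reads `k ≤ 0`.
    by_contra hn
    have : n = 0 ∨ n = 1 := by omega
    rcases this with rfl | rfl <;> norm_num at h <;> linarith
  have hn' : (2 : ℝ) ≤ n := by exact_mod_cast hn
  have hlog : 1 / 2 ≤ Real.log n := by
    have := Real.log_le_log (by norm_num) hn'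
    linarith [Real.log_two_gt_d9]
  have hpos : 0 < (n : ℝ) / Real.log n := by positivity
  -- The constant `1 / 2` is chosen so that its sixth power is `(1 / 8) ^ 2`.
  have h6 : (k : ℝ) ^ 6 ≤ 1 / 64 * (n / Real.log n) := by
    calc (k : ℝ) ^ 6 ≤ (1 / 2 * ((n : ℝ) / Real.log n) ^ ((1 : ℝ) / 6)) ^ 6 := by gcongr
      _ = 1 / 64 * (n / Real.log n) := by
        rw [mul_pow, ← Real.rpow_natCast (_ ^ _), ← Real.rpow_mul hpos.le]
        norm_num
  have h6' : (k : ℝ) ^ 6 * Real.log n ≤ 1 / 64 * n := by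
    rw [mul_div_assoc', le_div_iff₀ (by linarith)] at h6
    exact h6
  refine ⟨hn, ?_, ?_⟩
  · have h1 : (k : ℝ) ^ 6 * (1 / 2) ≤ k ^ 6 * Real.log n := by gcongr
    have h2 : (k : ℝ) ^ 2 * 32 ^ 4 ≤ k ^ 2 * k ^ 4 := by gcongr
    nlinarith
  · refine abs_le_of_sq_le_sq' (b := (1 / 8 : ℝ)) ?_ (by norm_num) |>.2
    rw [mul_pow, Real.sq_sqrt (by positivity), ← pow_mul, mul_div_assoc',
      div_le_iff₀ (by linarith)]
    linarith

theorem mainTheorem1 :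
    ∃ ε > (0 : ℝ), ∃ a > (0 : ℝ), ∃ b > (0 : ℝ),
      ∀ (n k : ℕ) [NeZero n] (c : Fin n → Fin k),
        (k : ℝ) ≤ ε * ((n : ℝ) / Real.log (n : ℝ)) ^ ((1 : ℝ) / 6) →
        (∃ u v : Fin n, c u ≠ c v) →
        1 - (n : ℝ) ^ (-b) ≤
          (contactLaw n).real {contact : ℕ → Fin n → Fin n |
            ENNReal.ofReal (a * monochromaticDistance c) ≤
              (usdConvergenceTime c contact : ENNReal)} := by
  refine ⟨1 / 2, by norm_num, 1 / 32, by norm_num, 1, one_pos, fun n k _ c hk hc => ?_⟩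
  -- Below `32` the claimed time is less than `1`, and two colors are present at time `0`.
  rcases lt_or_ge (monochromaticDistance c) 32 with hD | hD
  · have hall : {contact : ℕ → Fin n → Fin n |
        ENNReal.ofReal (1 / 32 * monochromaticDistance c) ≤
          (usdConvergenceTime c contact : ENNReal)} = Set.univ := by
      refine Set.eq_univ_of_forall fun ω => le_usdConvergenceTime (T := 1) ?_ fun t ht => ?_
      · push_cast
        linarith
      · obtain rfl : t = 0 := by omega
        exact not_converged_zero hc ω
    rw [hall, probReal_univ]
    exact sub_le_self _ (by positivity)
  have hDk := monochromaticDistance_le c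
  obtain ⟨hn, hk2, hk3⟩ := color_number_bounds (by exact_mod_cast hD.trans hDk) hk
  have hn0 : (0 : ℝ) < n := by exact_mod_cast (by omega : 0 < n)
  set T := ⌊monochromaticDistance c / 32⌋₊ with hTdef
  have hT : (T : ℝ) ≤ monochromaticDistance c / 32 := Nat.floor_le (by positivity)
  have hTk : (T : ℝ) ≤ k := by linarith
  -- This `δ` gives failure probability `2 / n ^ 2` per color and round; there are `T * k ≤ k ^ 2 ≤
  -- n / 2` such pairs.
  have hprob := contactLaw_deviation c T (Real.sqrt_nonneg (Real.log n / n))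
  have hlog : 0 ≤ Real.log n := Real.log_natCast_nonneg n
  have hexp : Real.exp (-2 * n * √(Real.log n / n) ^ 2) = ((n : ℝ) ^ 2)⁻¹ := by
    rw [Real.sq_sqrt (by positivity), mul_assoc, mul_div_cancel₀ _ hn0.ne', neg_mul,
      Real.exp_neg, two_mul, Real.exp_add, Real.exp_log hn0, sq]
  rw [hexp] at hprob
  calc 1 - (n : ℝ) ^ (-1 : ℝ) ≤ 1 - T * (k * (2 * ((n : ℝ) ^ 2)⁻¹)) := by
        have : T * (k * (2 * ((n : ℝ) ^ 2)⁻¹)) ≤ (n : ℝ) ^ (-1 : ℝ) := by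
          calc T * (k * (2 * ((n : ℝ) ^ 2)⁻¹)) ≤ k * (k * (2 * ((n : ℝ) ^ 2)⁻¹)) := by gcongr
            _ = 2 * k ^ 2 * ((n : ℝ) ^ 2)⁻¹ := by ring
            _ ≤ n * ((n : ℝ) ^ 2)⁻¹ := by gcongr
            _ = (n : ℝ) ^ (-1 : ℝ) := by
              rw [Real.rpow_neg_one]
              field_simp
        linarith
    _ ≤ _ := hprob.trans (measureReal_mono fun ω hω => ?_)
  -- Times `0` to `T` are all excluded, which makes up for the floor in `T`.
  refine le_usdConvergenceTime (T := T + 1) ?_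
    (not_converged_of_deviation_le hc hD hk3 hT hω)
  push_cast
  linarith [Nat.lt_floor_add_one (monochromaticDistance c / 32)]
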